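/- All random variables are defined on a probability space $(\Omega,\mathcal F,\mathbb P)$, and all $\sigma$-fields are completed by the null events. For each $n\ge 1$ let $\mathfrak H_n$ be a real separable Hilbert space and $X_n=\{X_n(h):h\in\mathfrak H_n\}$ a family of centered, square integrable real random variables with $\mathbb E[X_n(f)X_n(g)]=(f,g)_{\mathfrak H_n}$ for all $f,g\in\mathfrak H_n$. Let $\pi^{(n)}=\{\pi^{(n)}_t:t\in[0,1]\}$ be a family of orthogonal projections of $\mathfrak H_n$ with $\pi^{(n)}_0=0$, $\pi^{(n)}_1=\mathrm{id}$, $\pi^{(n)}_s\mathfrak H_n\subseteq\pi^{(n)}_t\mathfrak H_n$ for $s<t$, and $t\mapsto\pi_t^{(n)}h$ continuous for every $h$, such that for all $m\ge 2$, $h_1,\dots,h_m\in\mathfrak H_n$ and $0\le s_0<s_1<\dots<s_m\le 1$ the variables $X_n((\pi^{(n)}_{s_j}-\pi^{(n)}_{s_{j-1}})h_j)$, $j=1,\dots,m$, are jointly independent. Put $\mathcal F^{(n)}_t=\sigma\{X_n(\pi^{(n)}_th):h\in\mathfrak H_n\}$. Let $u_n$ be a $\sigma(X_n)$-measurable $\mathfrak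 H_n$-valued random variable with $\mathbb E\|u_n\|^2<\infty$ that is adapted: $(u_n,\pi^{(n)}_th)$ is $\mathcal F^{(n)}_t$-measurable for all $t\in[0,1]$ and $h\in\mathfrak H_n$. Let $J_n=J_{X_n}^{\pi^{(n)}}(u_n)$ be (a version of) its stochastic integral, that is, the $L^2(\mathbb P)$-limit of the integrals $\sum_i\Phi_iX_n((\pi^{(n)}_{b_i}-\pi^{(n)}_{a_i})f_i)$ of finite sums $\sum_i\Phi_i(\pi^{(n)}_{b_i}-\pi^{(n)}_{a_i})f_i$ converging to $u_n$ in $L^2(\mathbb P;\mathfrak H_n)$, where $a_i<b_i$, $f_i\in\mathfrak H_n$ and $\Phi_i$ is square integrable and $\mathcal F^{(n)}_{a_i}$-measurable. Let $t_n\in[0,1]$, and let $\phi(\lambda)=\phi(\lambda,\omega)$ be a jointly measurable map such that, for almost every $\omega$, $\lambda\mapsto\phi(\lambda,\omega)$ is the characteristic function of $\mu(\cdot,\omega)$ and has no zero, for some random probability measure $\mu$ on $\mathbb R$. Suppose that $$\mathbb E\big[e^{i\lambda J_n}\,\big|\,\mathcal F^{(n)}_{t_n}\big]\longrightarrow\phi(\lambda)\quad\text{in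 probability as }n\to\infty,\ \text{for every }\lambda\in\mathbb R,$$ and that there are a finite random variable $C>0$ and a real $\eta>0$ such that, almost surely, $$\mathbb E\big[|J_n|^\eta\,\big|\,\mathcal F^{(n)}_{t_n}\big]<C\quad\text{for all }n\ge 1.$$ Then there is a subsequence $(n(k))_{k\ge1}$ such that, almost surely, $$\mathbb E\big[e^{i\lambda J_{n(k)}}\,\big|\,\mathcal F^{(n(k))}_{t_{n(k)}}\big]\underset{k\to\infty}{\longrightarrow}\phi(\lambda)\quad\text{for every }\lambda\in\mathbb R,$$ where the conditional characteristic functions are computed from the regular conditional laws of $J_{n(k)}$ given $\mathcal F^{(n(k))}_{t_{n(k)}}$. -/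

import Mathlib

open MeasureTheory ProbabilityTheory Filter Topology
open scoped ENNReal unitInterval

noncomputable section

namespace AdaptedIntegral

/-! ### Resolutions of the identity and isometric random fields -/

/-- A continuous resolution of the identity `π = {π_t : t ∈ [0,1]}` on a Hilbert space:
an increasing, strongly continuous family of orthogonal projections from `0` to `id`. -/
structure IsResolution {H : Type*} [NormedAddCommGroup H] [InnerProductSpace ℝ H]
    [CompleteSpace H] (π : I → H →L[ℝ] H) : Prop where
  isStarProjection : ∀ t, IsStarProjection (π t)
  map_zero : π 0 = 0
  map_one : π 1 = ContinuousLinearMap.id ℝ H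
  range_subset : ∀ s t, s < t → Set.range (π s) ⊆ Set.range (π t)
  continuous : ∀ h : H, Continuous fun t => π t h

/-- A centered, square integrable random field `X = {X(h) : h ∈ H}` such that
`E[X(f) X(g)] = (f, g)`. -/
structure IsIsometricField {Ω : Type*} [MeasurableSpace Ω] (P : Measure Ω)
    {H : Type*} [NormedAddCommGroup H] [InnerProductSpace ℝ H] (X : H → Ω → ℝ) : Prop where
  measurable : ∀ h, Measurable (X h)
  memLp : ∀ h, MemLp (X h) 2 P
  centered : ∀ h, ∫ ω, X h ω ∂P = 0
  isometry : ∀ f g, ∫ ω, X f ω * X g ω ∂P = inner ℝ f g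

/-- `X` has independent increments along `π`: for all `t_0 < t_1 < ... < t_m` and
`h_1, ..., h_m` with `m ≥ 2`, the variables `X((π_{t_j} - π_{t_{j-1}}) h_j)` are jointly
independent. -/
def HasIndepIncrements {Ω : Type*} [MeasurableSpace Ω] (P : Measure Ω)
    {H : Type*} [NormedAddCommGroup H] [InnerProductSpace ℝ H]
    (X : H → Ω → ℝ) (π : I → H →L[ℝ] H) : Prop :=
  ∀ (m : ℕ), 2 ≤ m → ∀ (h : Fin m → H) (t : Fin (m + 1) → I), StrictMono t →
    iIndepFun (fun j : Fin m => X ((π (t j.succ) - π (t j.castSucc)) (h j))) P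

/-- The class of all resolutions of the identity `π` along which the isometric field `X` has
independent increments. -/
structure IsResolutionFor {Ω : Type*} [MeasurableSpace Ω] (P : Measure Ω)
    {H : Type*} [NormedAddCommGroup H] [InnerProductSpace ℝ H] [CompleteSpace H]
    (X : H → Ω → ℝ) (π : I → H →L[ℝ] H) : Prop where
  isResolution : IsResolution π
  hasIndepIncrements : HasIndepIncrements P X π

/-! ### σ-fields (all of them completed by the null events) -/

/-- The σ-field generated by the `P`-null events. -/
abbrev nullField {Ω : Type*} [MeasurableSpace Ω] (P : Measure Ω) : MeasurableSpace Ω :=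
  MeasurableSpace.generateFrom {N | MeasurableSet N ∧ P N = 0}

/-- The completed σ-field `σ(X) = σ{X(f) : f ∈ H}`. -/
abbrev fieldOf {Ω : Type*} [MeasurableSpace Ω] (P : Measure Ω) {H : Type*} (X : H → Ω → ℝ) :
    MeasurableSpace Ω :=
  (⨆ f : H, (borel ℝ).comap (X f)) ⊔ nullField P

/-- The (completed) filtration `F_t^π(X) = σ{X(π_t f) : f ∈ H}`. -/
abbrev resFiltration {Ω : Type*} [MeasurableSpace Ω] (P : Measure Ω)
    {H : Type*} [NormedAddCommGroup H] [InnerProductSpace ℝ H]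
    (X : H → Ω → ℝ) (π : I → H →L[ℝ] H) (t : I) : MeasurableSpace Ω :=
  fieldOf P fun f : H => X (π t f)

theorem fieldOf_le {Ω : Type*} [mΩ : MeasurableSpace Ω] (P : Measure Ω) {H : Type*}
    {X : H → Ω → ℝ} (hX : ∀ f, Measurable (X f)) : fieldOf P X ≤ mΩ := by
  refine sup_le (iSup_le fun f => ?_) (MeasurableSpace.generateFrom_le fun N hN => hN.1)
  rw [← BorelSpace.measurable_eq (α := ℝ)]
  exact (hX f).comap_le

/-! ### Adapted integrands and their stochastic integral -/

/-- The space `L²_π(H, X)`: the `σ(X)`-measurable, square integrable, `H`-valued random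
variables `u` such that `(u, π_t h)` is `F_t^π(X)`-measurable for all `t` and `h`. -/
structure IsAdaptedL2 {Ω : Type*} [MeasurableSpace Ω] (P : Measure Ω)
    {H : Type*} [NormedAddCommGroup H] [InnerProductSpace ℝ H]
    (X : H → Ω → ℝ) (π : I → H →L[ℝ] H) (u : Ω → H) : Prop where
  stronglyMeasurable : StronglyMeasurable[fieldOf P X] u
  memLp : MemLp u 2 P
  adapted : ∀ (t : I) (h : H),
    Measurable[resFiltration P X π t] fun ω => inner ℝ (u ω) (π t h)

/-- The data of an elementary adapted integrand `∑_i Φ_i (π_{t_i} - π_{s_i}) f_i`, where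
`s_i < t_i` and `Φ_i` is square integrable and `F_{s_i}^π(X)`-measurable
(scalar coefficients are absorbed in the `Φ_i`). -/
structure Elementary {Ω : Type*} [MeasurableSpace Ω] (P : Measure Ω)
    {H : Type*} [NormedAddCommGroup H] [InnerProductSpace ℝ H]
    (X : H → Ω → ℝ) (π : I → H →L[ℝ] H) where
  /-- the number of terms -/
  num : ℕ
  /-- the left end points -/
  left : Fin num → I
  /-- the right end points -/
  right : Fin num → I
  /-- the directions -/
  dir : Fin num → H
  /-- the random coefficients -/
  coeff : Fin num → Ω → ℝ
  left_lt_right : ∀ i, left i < right i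
  measurable_coeff : ∀ i, Measurable[resFiltration P X π (left i)] (coeff i)
  memLp_coeff : ∀ i, MemLp (coeff i) 2 P

/-- The `H`-valued random variable `∑_i Φ_i (π_{t_i} - π_{s_i}) f_i`. -/
def Elementary.toFun {Ω : Type*} [MeasurableSpace Ω] {P : Measure Ω}
    {H : Type*} [NormedAddCommGroup H] [InnerProductSpace ℝ H]
    {X : H → Ω → ℝ} {π : I → H →L[ℝ] H} (e : Elementary P X π) (ω : Ω) : H :=
  ∑ i, e.coeff i ω • (π (e.right i) - π (e.left i)) (e.dir i)

/-- The integral `∑_i Φ_i X((π_{t_i} - π_{s_i}) f_i)` of an elementary integrand. -/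
def Elementary.integral {Ω : Type*} [MeasurableSpace Ω] {P : Measure Ω}
    {H : Type*} [NormedAddCommGroup H] [InnerProductSpace ℝ H]
    {X : H → Ω → ℝ} {π : I → H →L[ℝ] H} (e : Elementary P X π) (ω : Ω) : ℝ :=
  ∑ i, e.coeff i ω * X ((π (e.right i) - π (e.left i)) (e.dir i)) ω

/-- `J` is (a version of) the stochastic integral `J_X^π(u)`: it is the `L²(P)`-limit of the
integrals of elementary adapted integrands that converge to `u` in `L²(P; H)`. -/
structure IsIntegralOf {Ω : Type*} [MeasurableSpace Ω] (P : Measure Ω)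
    {H : Type*} [NormedAddCommGroup H] [InnerProductSpace ℝ H]
    (X : H → Ω → ℝ) (π : I → H →L[ℝ] H) (u : Ω → H) (J : Ω → ℝ) : Prop where
  memLp : MemLp J 2 P
  exists_approx : ∃ e : ℕ → Elementary P X π,
    Tendsto (fun k => eLpNorm (fun ω => (e k).toFun ω - u ω) 2 P) atTop (𝓝 0) ∧
    Tendsto (fun k => eLpNorm (fun ω => (e k).integral ω - J ω) 2 P) atTop (𝓝 0)

/-! ### Random characteristic functions -/

/-- `φ` is the random characteristic function of a random probability measure on `ℝ`. -/
def IsRandomCharFun {Ω : Type*} [MeasurableSpace Ω] (P : Measure Ω) (φ : ℝ → Ω → ℂ) : Prop :=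
  Measurable (Function.uncurry φ) ∧
    ∃ μ : Ω → Measure ℝ, Measurable μ ∧ (∀ᵐ ω ∂P, IsProbabilityMeasure (μ ω)) ∧
      ∀ᵐ ω ∂P, ∀ l : ℝ, φ l ω = charFun (μ ω) l

/-- `φ` is a random characteristic function that almost surely has no zero. -/
def IsNonvanishingRandomCharFun {Ω : Type*} [MeasurableSpace Ω] (P : Measure Ω)
    (φ : ℝ → Ω → ℂ) : Prop :=
  IsRandomCharFun P φ ∧ ∀ᵐ ω ∂P, ∀ l : ℝ, φ l ω ≠ 0

/-- The regular conditional law of the real random variable `Y` given the σ-field `m`. -/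
def condLaw {Ω : Type*} (m : MeasurableSpace Ω) [mΩ : MeasurableSpace Ω] (P : Measure Ω)
    [IsFiniteMeasure P] (Y : Ω → ℝ) (ω : Ω) : Measure ℝ :=
  @condDistrib Ω Ω ℝ _ _ _ mΩ m Y id P _ ω

/-- The conditional characteristic function `E[exp(i l Y) | m](ω)`, in its version given by the
regular conditional law of `Y` given `m`; this is continuous in `l` for every `ω`. -/
def condCharFun {Ω : Type*} (m : MeasurableSpace Ω) [mΩ : MeasurableSpace Ω] (P : Measure Ω)
    [IsFiniteMeasure P] (Y : Ω → ℝ) (l : ℝ) (ω : Ω) : ℂ :=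
  charFun (condLaw m P Y ω) l

/-- `condCharFun` is indeed a version of the conditional expectation `E[exp(i l Y) | m]`. -/
theorem condCharFun_ae_eq {Ω : Type*} {m : MeasurableSpace Ω} [mΩ : MeasurableSpace Ω]
    (hm : m ≤ mΩ) (P : Measure Ω) [IsFiniteMeasure P] {Y : Ω → ℝ}
    (hY : AEMeasurable Y P) (l : ℝ) :
    condCharFun m P Y l =ᵐ[P] P[fun ω => Complex.exp (Complex.I * l * Y ω) | m] := by
  have hf : StronglyMeasurable fun y : ℝ => Complex.exp (l * y * Complex.I) :=
    (by fun_prop : Continuous fun y : ℝ => Complex.exp (l * y * Complex.I)).stronglyMeasurable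
  have hint : Integrable (fun ω => Complex.exp (l * Y ω * Complex.I)) P := by
    refine Integrable.of_bound
      (hf.measurable.comp_aemeasurable hY).aestronglyMeasurable 1 (ae_of_all _ fun ω => ?_)
    have := Complex.norm_exp_ofReal_mul_I (l * Y ω)
    push_cast at this
    exact this.le
  have h := condExp_ae_eq_integral_condDistrib (mβ := m) (X := (id : Ω → Ω))
    (measurable_id'' hm) hY hf hint
  rw [MeasurableSpace.comap_id] at h
  have e : (fun ω => Complex.exp (Complex.I * l * Y ω))
      = fun ω => Complex.exp (l * Y ω * Complex.I) := by
    funext ω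
    congr 1
    ring
  rw [e]
  refine EventuallyEq.trans (ae_of_all _ fun ω => ?_) h.symm
  simp only [condCharFun, condLaw, charFun_apply_real, id]

end AdaptedIntegral

end

namespace MeasureTheory

/-! Convergence in probability at each fixed `λ` only gives almost sure subsequential convergence at
countably many `λ` simultaneously; a diagonal extraction achieves this at all rationals. To reach
every real `λ` outside one null set, fix `ω` and use equicontinuity: the conditional moment bound
gives all conditional characteristic functions the common Hölder modulus `2 (1 + C ω) |l - l'| ^ min
η 1` (`norm_charFun_sub_le`), while `φ · ω`, being a characteristic function, is continuous. An ε/3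
argument (`tendsto_charFun_of_forall_rat`) then finishes. `lintegral_condLaw_ae_eq` transfers the
moment bound from conditional expectations to regular conditional laws. -/

/-- Convergence in measure of countably many sequences of functions yields a common subsequence
along which all of them converge almost everywhere. -/
theorem TendstoInMeasure.exists_strictMono_forall_tendsto_ae {α E : Type*}
    [PseudoEMetricSpace E] {_ : MeasurableSpace α} {μ : Measure α}
    {f : ℕ → ℕ → α → E} {g : ℕ → α → E}
    (h : ∀ i, TendstoInMeasure μ (f i) atTop (g i)) :
    ∃ k : ℕ → ℕ, StrictMono k ∧
      ∀ᵐ x ∂μ, ∀ i, Tendsto (fun j => f i (k j) x) atTop (𝓝 (g i x)) := by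
  have hpos : ∀ j : ℕ, (0 : ℝ≥0∞) < 2⁻¹ ^ j := fun j => ENNReal.pow_pos (by simp) j
  -- Stage `j` controls only the first `j + 1` sequences, so finitely many conditions have to hold
  -- at once.
  have hsmall : ∀ j : ℕ, ∀ᶠ n in atTop, ∀ i ∈ Finset.range (j + 1),
      μ {x | (2⁻¹ : ℝ≥0∞) ^ j ≤ edist (f i n x) (g i x)} ≤ 2⁻¹ ^ j := fun j =>
    (Finset.eventually_all _).2 fun i _ => (h i _ (hpos j)).eventually_le_const (hpos j)
  obtain ⟨k, hk, hkP⟩ := extraction_forall_of_eventually hsmall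
  refine ⟨k, hk, ae_all_iff.2 fun i => ?_⟩
  -- The `i`-th sequence is controlled only from stage `i` on, hence the shift; the geometric bound
  -- then feeds Borel–Cantelli.
  have hsum : ∑' j, μ {x | (2⁻¹ : ℝ≥0∞) ^ (j + i) ≤ edist (f i (k (j + i)) x) (g i x)} ≠ ∞ := by
    refine ne_top_of_le_ne_top (b := ∑' j : ℕ, (2⁻¹ : ℝ≥0∞) ^ j) (by simp) ?_
    refine ENNReal.tsum_le_tsum fun j => (hkP (j + i) i (by simp)).trans ?_
    exact pow_le_pow_right_of_le_one' (by simp) (Nat.le_add_right j i)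
  filter_upwards [ae_eventually_notMem hsum] with x hx
  rw [← tendsto_add_atTop_iff_nat i, tendsto_iff_edist_tendsto_0]
  refine tendsto_of_tendsto_of_tendsto_of_le_of_le' tendsto_const_nhds
    ((tendsto_add_atTop_iff_nat i).2
      (ENNReal.tendsto_pow_atTop_nhds_zero_of_lt_one (r := 2⁻¹) (by simp)))
    (Eventually.of_forall fun _ => zero_le) ?_
  filter_upwards [hx] with j hj
  simpa using (not_le.1 hj).le

end MeasureTheory

namespace ProbabilityTheory

/-- Disintegration of the joint law of `(X, Y)` over `s ×ˢ univ`. As `f` is nonnegative, no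
integrability is needed. -/
theorem setLIntegral_preimage_lintegral_condDistrib {α β S : Type*} {mα : MeasurableSpace α}
    {mβ : MeasurableSpace β} [MeasurableSpace S] [StandardBorelSpace S] [Nonempty S]
    {μ : Measure α} [IsFiniteMeasure μ] {X : α → β} {Y : α → S}
    (hX : Measurable X) (hY : AEMeasurable Y μ) {f : S → ℝ≥0∞} (hf : Measurable f)
    {s : Set β} (hs : MeasurableSet s) :
    ∫⁻ a in X ⁻¹' s, ∫⁻ y, f y ∂condDistrib Y X μ (X a) ∂μ = ∫⁻ a in X ⁻¹' s, f (Y a) ∂μ := by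
  have hind : Measurable ((s ×ˢ Set.univ).indicator fun p : β × S => f p.2) :=
    (hf.comp measurable_snd).indicator (hs.prod .univ)
  have hκ : Measurable fun b => ∫⁻ y, f y ∂condDistrib Y X μ b := hf.lintegral_kernel
  calc ∫⁻ a in X ⁻¹' s, ∫⁻ y, f y ∂condDistrib Y X μ (X a) ∂μ
      = ∫⁻ b in s, ∫⁻ y, f y ∂condDistrib Y X μ b ∂(μ.map X) := (setLIntegral_map hs hκ hX).symm
    _ = ∫⁻ p in s ×ˢ Set.univ, f p.2 ∂(μ.map X ⊗ₘ condDistrib Y X μ) := by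
        rw [Measure.setLIntegral_compProd (f := fun p => f p.2) (hf.comp measurable_snd) hs .univ]
        simp
    _ = ∫⁻ a, (s ×ˢ Set.univ).indicator (fun p : β × S => f p.2) (X a, Y a) ∂μ := by
        rw [compProd_map_condDistrib hY, ← lintegral_indicator (hs.prod .univ),
          lintegral_map' hind.aemeasurable (hX.aemeasurable.prodMk hY)]
    _ = ∫⁻ a in X ⁻¹' s, f (Y a) ∂μ := by
        rw [← lintegral_indicator (hX hs)]
        refine lintegral_congr fun a => ?_
        by_cases ha : X a ∈ s <;> simp [ha]

end ProbabilityTheory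

namespace AdaptedIntegral

instance {Ω : Type*} (m : MeasurableSpace Ω) [mΩ : MeasurableSpace Ω] (P : Measure Ω)
    [IsFiniteMeasure P] (Y : Ω → ℝ) (ω : Ω) : IsProbabilityMeasure (condLaw m P Y ω) := by
  unfold condLaw
  infer_instance

/-- Both sides have the same integral over every `m`-measurable set: take `X = id`, viewed as a map
into `Ω` equipped with `m`, in the disintegration identity. -/
theorem lintegral_condLaw_ae_eq {Ω : Type*} {m : MeasurableSpace Ω} [mΩ : MeasurableSpace Ω]
    (hm : m ≤ mΩ) (P : Measure Ω) [IsFiniteMeasure P] {Y : Ω → ℝ} (hY : AEMeasurable Y P)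
    {f : ℝ → ℝ≥0∞} (hf : Measurable f) :
    (fun ω => ∫⁻ y, f y ∂condLaw m P Y ω) =ᵐ[P] P⁻[fun ω => f (Y ω) | m] := by
  have hmeas : Measurable[m] fun ω => ∫⁻ y, f y ∂condLaw m P Y ω :=
    hf.lintegral_kernel
  refine ae_eq_condLExp hm P _ hmeas fun s hs => ?_
  exact setLIntegral_preimage_lintegral_condDistrib (mβ := m) (X := id)
    (measurable_id'' hm) hY hf hs

/-- Interpolates between the Lipschitz bound `|a - b|`, used when `|a - b| ≤ 1`, and the trivial
bound `2`, used otherwise. -/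
theorem norm_cexp_sub_cexp_le (a b : ℝ) {θ : ℝ} (h0 : 0 < θ) (h1 : θ ≤ 1) :
    ‖Complex.exp (a * Complex.I) - Complex.exp (b * Complex.I)‖ ≤ 2 * |a - b| ^ θ := by
  rcases le_total |a - b| 1 with h | h
  · have e : Complex.exp (a * Complex.I) - Complex.exp (b * Complex.I)
        = Complex.exp (b * Complex.I) * (Complex.exp (Complex.I * ((a - b : ℝ) : ℂ)) - 1) := by
      rw [mul_sub, ← Complex.exp_add]
      push_cast
      ring_nf
    have h2 : |a - b| ≤ |a - b| ^ θ := by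
      simpa using Real.rpow_le_rpow_of_exponent_ge_of_imp (abs_nonneg (a - b)) h h1
        fun _ => by simp [h0.ne']
    rw [e, norm_mul, Complex.norm_exp_ofReal_mul_I, one_mul]
    refine (Real.norm_exp_I_mul_ofReal_sub_one_le).trans ?_
    rw [Real.norm_eq_abs]
    linarith [abs_nonneg (a - b)]
  · refine (norm_sub_le _ _).trans ?_
    rw [Complex.norm_exp_ofReal_mul_I, Complex.norm_exp_ofReal_mul_I]
    linarith [Real.one_le_rpow h h0.le]

/-- An absolute moment of order `η` makes a characteristic function Hölder continuous of order
`min η 1`, with a constant that depends on the moment only. -/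
theorem norm_charFun_sub_le (ν : Measure ℝ) [IsProbabilityMeasure ν] {η c : ℝ} (hη : 0 < η)
    (hc : 0 ≤ c) (hν : ∫⁻ x, ENNReal.ofReal (|x| ^ η) ∂ν ≤ ENNReal.ofReal c) (l l' : ℝ) :
    ‖charFun ν l - charFun ν l'‖ ≤ 2 * |l - l'| ^ min η 1 * (1 + c) := by
  set θ := min η 1
  have hθ : 0 < θ := lt_min hη one_pos
  have hmeas : Measurable fun x : ℝ => |x| ^ η := by fun_prop
  have hpos : ∀ x : ℝ, 0 ≤ |x| ^ η := fun x => Real.rpow_nonneg (abs_nonneg x) η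
  have hint : Integrable (fun x : ℝ => |x| ^ η) ν :=
    ⟨hmeas.aestronglyMeasurable, by
      rw [hasFiniteIntegral_iff_ofReal (ae_of_all _ hpos)]
      exact hν.trans_lt ENNReal.ofReal_lt_top⟩
  have hle : ∫ x, |x| ^ η ∂ν ≤ c := by
    rw [integral_eq_lintegral_of_nonneg_ae (ae_of_all _ hpos) hmeas.aestronglyMeasurable]
    exact ENNReal.toReal_le_of_le_ofReal hc hν
  have hexp : ∀ r : ℝ, Integrable (fun x : ℝ => Complex.exp (r * x * Complex.I)) ν := fun r =>
    Integrable.of_bound (by fun_prop : Continuous _).aestronglyMeasurable 1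
      (ae_of_all _ fun x => by
        have := Complex.norm_exp_ofReal_mul_I (r * x)
        push_cast at this
        exact this.le)
  rw [charFun_apply_real, charFun_apply_real, ← integral_sub (hexp l) (hexp l')]
  calc ‖∫ x : ℝ, (Complex.exp (l * x * Complex.I) - Complex.exp (l' * x * Complex.I)) ∂ν‖
      ≤ ∫ x : ℝ, 2 * |l - l'| ^ θ * (1 + |x| ^ η) ∂ν := by
        refine norm_integral_le_of_norm_le (((integrable_const 1).add hint).const_mul _)
          (ae_of_all _ fun x => ?_)
        have h := norm_cexp_sub_cexp_le (l * x) (l' * x) hθ (min_le_right η 1)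
        push_cast at h
        refine h.trans ?_
        rw [← sub_mul, abs_mul, Real.mul_rpow (abs_nonneg _) (abs_nonneg _), ← mul_assoc]
        refine mul_le_mul_of_nonneg_left ?_ (by positivity)
        -- `|x| ^ θ ≤ 1 + |x| ^ η`: the first term dominates for `|x| ≤ 1`, the second for `|x| ≥ 1`
        -- because `θ ≤ η`.
        rcases le_total |x| 1 with hx | hx
        · linarith [Real.rpow_le_one (abs_nonneg x) hx hθ.le, hpos x]
        · linarith [Real.rpow_le_rpow_of_exponent_le hx (min_le_left η 1)]
    _ = 2 * |l - l'| ^ θ * (1 + ∫ x, |x| ^ η ∂ν) := by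
        rw [integral_const_mul, integral_add (integrable_const 1) hint]
        simp
    _ ≤ 2 * |l - l'| ^ θ * (1 + c) := by gcongr

/-- Under a uniform absolute moment bound, convergence of characteristic functions at the rational
points to a continuous function implies convergence everywhere. -/
theorem tendsto_charFun_of_forall_rat (ν : ℕ → Measure ℝ) [∀ n, IsProbabilityMeasure (ν n)]
    {η c : ℝ} (hη : 0 < η) (hc : 0 ≤ c)
    (hν : ∀ n, ∫⁻ x, ENNReal.ofReal (|x| ^ η) ∂ν n ≤ ENNReal.ofReal c)
    {g : ℝ → ℂ} (hg : Continuous g)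
    (h : ∀ q : ℚ, Tendsto (fun n => charFun (ν n) q) atTop (𝓝 (g q))) (l : ℝ) :
    Tendsto (fun n => charFun (ν n) l) atTop (𝓝 (g l)) := by
  rw [Metric.tendsto_atTop]
  intro ε hε
  have hmod : Tendsto (fun r : ℝ => 2 * |l - r| ^ min η 1 * (1 + c)) (𝓝 l) (𝓝 0) := by
    have hcont : Continuous fun r : ℝ => 2 * |l - r| ^ min η 1 * (1 + c) :=
      (((continuous_const.sub continuous_id).abs.rpow_const
        fun _ => Or.inr (lt_min hη one_pos).le).const_mul 2).mul_const _
    simpa [(lt_min hη one_pos).ne'] using hcont.tendsto l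
  -- The modulus does not depend on `n`, so the rational `q` near `l` can be chosen before `n`.
  have hev : ∀ᶠ r in 𝓝 l, 2 * |l - r| ^ min η 1 * (1 + c) < ε / 3 ∧ dist (g r) (g l) < ε / 3 :=
    (hmod.eventually_lt_const (by positivity)).and
      (Metric.tendsto_nhds.1 (hg.tendsto l) _ (by positivity))
  obtain ⟨U, hU, hUo, hlU⟩ := eventually_nhds_iff.1 hev
  obtain ⟨q, hq⟩ := Rat.denseRange_cast.exists_mem_open hUo ⟨l, hlU⟩
  obtain ⟨N, hN⟩ := Metric.tendsto_atTop.1 (h q) (ε / 3) (by positivity)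
  refine ⟨N, fun n hn => ?_⟩
  have h1 := norm_charFun_sub_le (ν n) hη hc (hν n) l q
  rw [← dist_eq_norm] at h1
  linarith [dist_triangle4 (charFun (ν n) l) (charFun (ν n) q) (g q) (g l), hN n hn,
    (hU q hq).1, (hU q hq).2]

end AdaptedIntegral

open AdaptedIntegral in
theorem proposition9
    {Ω : Type*} [MeasurableSpace Ω] (P : Measure Ω) [IsProbabilityMeasure P]
    (H : ℕ → Type*) [∀ n, NormedAddCommGroup (H n)] [∀ n, InnerProductSpace ℝ (H n)]
    [∀ n, CompleteSpace (H n)] [∀ n, TopologicalSpace.SeparableSpace (H n)]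
    (X : ∀ n, H n → Ω → ℝ) (hX : ∀ n, IsIsometricField P (X n))
    (π : ∀ n, I → H n →L[ℝ] H n) (hπ : ∀ n, IsResolutionFor P (X n) (π n))
    (u : ∀ n, Ω → H n) (hu : ∀ n, IsAdaptedL2 P (X n) (π n) (u n))
    (J : ℕ → Ω → ℝ) (hJ : ∀ n, IsIntegralOf P (X n) (π n) (u n) (J n))
    (t : ℕ → I)
    (φ : ℝ → Ω → ℂ) (hφ : IsNonvanishingRandomCharFun P φ)
    (hCV : ∀ l : ℝ, TendstoInMeasure P
      (fun n => P[fun ω => Complex.exp (Complex.I * l * J n ω) |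
        resFiltration P (X n) (π n) (t n)]) atTop (φ l))
    (C : Ω → ℝ) (hCmeas : Measurable C) (hCpos : ∀ ω, 0 < C ω)
    (η : ℝ) (hη : 0 < η)
    (hmom : ∀ n, ∀ᵐ ω ∂P,
      P⁻[fun ω' => ENNReal.ofReal (|J n ω'| ^ η) | resFiltration P (X n) (π n) (t n)] ω
        < ENNReal.ofReal (C ω)) :
    ∃ k : ℕ → ℕ, StrictMono k ∧
      ∀ᵐ ω ∂P, ∀ l : ℝ, Tendsto
        (fun j => condCharFun (resFiltration P (X (k j)) (π (k j)) (t (k j))) P (J (k j)) l ω)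
        atTop (𝓝 (φ l ω)) := by
  set m : ℕ → MeasurableSpace Ω := fun n => resFiltration P (X n) (π n) (t n)
  have hm : ∀ n, m n ≤ ‹MeasurableSpace Ω› := fun n =>
    fieldOf_le P fun f => (hX n).measurable _
  have hJm : ∀ n, AEMeasurable (J n) P := fun n => (hJ n).memLp.aestronglyMeasurable.aemeasurable
  obtain ⟨e, he⟩ := exists_surjective_nat ℚ
  have hrat : ∀ i, TendstoInMeasure P (fun n => condCharFun (m n) P (J n) (e i)) atTop
      (φ (e i)) := fun i =>
    (hCV (e i)).congr_left fun n => (condCharFun_ae_eq (hm n) P (hJm n) (e i)).symm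
  obtain ⟨k, hk, hlim⟩ := TendstoInMeasure.exists_strictMono_forall_tendsto_ae hrat
  refine ⟨k, hk, ?_⟩
  obtain ⟨⟨-, μ, -, hμ, hφμ⟩, -⟩ := hφ
  -- Countably many `n`, hence a single null set; off it, `C ω` is a constant serving every `n`.
  have hbound : ∀ᵐ ω ∂P, ∀ n,
      ∫⁻ x, ENNReal.ofReal (|x| ^ η) ∂condLaw (m n) P (J n) ω ≤ ENNReal.ofReal (C ω) := by
    refine ae_all_iff.2 fun n => ?_
    filter_upwards [hmom n, lintegral_condLaw_ae_eq (hm n) P (hJm n)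
      (f := fun x => ENNReal.ofReal (|x| ^ η)) (by fun_prop)] with ω h1 h2
    exact h2.le.trans h1.le
  filter_upwards [hlim, hμ, hφμ, hbound] with ω hω hprob hφω hb l
  have hcont : Continuous fun r => φ r ω := by
    simp_rw [hφω]
    exact continuous_charFun
  refine tendsto_charFun_of_forall_rat (fun j => condLaw (m (k j)) P (J (k j)) ω) hη (hCpos ω).le
    (fun j => hb (k j)) hcont (fun q => ?_) l
  obtain ⟨i, rfl⟩ := he q
  exact hω i
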